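/- Let $q:\mathbb{Z}^n\to\mathbb{Z}$ be an integral quadratic form with polarization $b_q(x,y)=q(x+y)-q(x)-q(y)$. It is a unit form if $q(e_i)=1$ for each canonical basis vector $e_i$, non-negative if $q(x)\ge 0$ for all $x$, and connected if the graph on $\{1,\ldots,n\}$ joining $i\ne j$ whenever $b_q(e_i,e_j)\neq 0$ is connected. It has Dynkin type $\mathbb{A}_r$ if, after an invertible $\mathbb{Z}$-linear change of variables, it becomes $q_{\mathbb{A}_r}\oplus 0$, where $q_{\mathbb{A}_r}(y)=\sum_{i=1}^r y_i^2-\sum_{i=1}^{r-1}y_iy_{i+1}$ and $0$ is the zero form in the remaining variables. Let $\check b_q$ be the bilinear form with $\check b_q(x,x)=q(x)$ whose Gram matrix in the canonical basis is upper triangular. The radical of $q$ is $\mathrm{rad}(q)=\{x : b_q(x,y)=0 \text{ for all } y\in\mathbb{Z}^n\}$, and the corank of $q$ is its rank. The reduced corank of $q$ is the rank of $\{x\in\mathrm{rad}(q) : \check b_q(y,x)=0\text{ for all }y\in\mathrm{rad}(q)\}$. The degree of degeneracy $\mathbf{d}_q$ is half of the rank of the (skew-symmetric) restriction of $\check b_q$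 to $\mathrm{rad}(q)$, which is an even number. Let $Q$ be a connected quiver without loops, with vertices $1,\ldots,m$ and arrows $1,\ldots,n$, and let $I(Q)$ be the $m\times n$ matrix whose $i$-th column is $e_{s(i)}-e_{t(i)}$, where $s(i)$ and $t(i)$ are the source and the target of the arrow $i$. Put $q_Q(x)=\tfrac12\|I(Q)x\|^2$. A walk $i_1^{\epsilon_1}\cdots i_k^{\epsilon_k}$ in $Q$ (with $\epsilon_t=\pm1$, the arrow $i_t$ being traversed backwards if $\epsilon_t=-1$) is minimally descending if for each $t<k$ the arrow $i_{t+1}$ is the largest among the arrows smaller than $i_t$ that are incident to the end point of $i_t^{\epsilon_t}$; it is structural if it is not a proper part of another minimally descending walk. Each vertex $v$ is the source of exactly one structural walk, and sending $v$ to the target of this walk defines a permutation $\xi^-_Q$ of the vertices. The cycle type of $Q$ is the partition of $m$ given by the cardinalities of the orbits of $\xi^-_Q$. Let $q$ be a connected non-negative unit form of Dynkin type $\mathbb{A}_r$, $r\ge 1$, and corank $c$. Then there is a connected loop-less quiver $Q$ with $r+1$ vertices and $n$ arrows such that $q=q_Q$, and all such quivers have the same cycle type $\mathrm{ct}(q)$,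 a partition of $r+1$. If $\ell(\mathrm{ct}(q))$ denotes the number of parts of $\mathrm{ct}(q)$, then the reduced corank of $q$ is $\ell(\mathrm{ct}(q))-1$, and the degree of degeneracy of $q$ is $$\mathbf{d}_q=\tfrac12\bigl[c-\ell(\mathrm{ct}(q))+1\bigr].$$ -/

import Mathlib

noncomputable section

namespace UnitForm

/-! ### Integral quadratic forms -/

/-- Integral quadratic forms `q : ℤⁿ → ℤ`. -/
abbrev IntForm (n : ℕ) := QuadraticForm ℤ (Fin n → ℤ)

variable {n m : ℕ}

/-- `q` is a unit form: `q(e_i) = 1` for every canonical basis vector. -/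
def IsUnitForm (q : IntForm n) : Prop := ∀ i, q (Pi.single i 1) = 1

/-- `q` is non-negative. -/
def IsNonneg (q : IntForm n) : Prop := ∀ x, 0 ≤ q x

/-- The graph on the variables of `q` in which two different variables `i`, `j` are adjacent iff
the coefficient `b_q(e_i, e_j)` of `x_i x_j` is not zero. -/
def formGraph (q : IntForm n) : SimpleGraph (Fin n) :=
  SimpleGraph.fromRel fun i j => QuadraticMap.polar q (Pi.single i 1) (Pi.single j 1) ≠ 0

/-- `q` is connected. -/
def IsConnected (q : IntForm n) : Prop := (formGraph q).Connected

open Classical in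
/-- The matrix `2 Id - Adj(𝔸_r)`, where `𝔸_r` is the path graph on `r` vertices: the symmetric Gram
matrix of the unit form `q_{𝔸_r}`. -/
def gramA (r : ℕ) : Matrix (Fin r) (Fin r) ℤ := (2 : ℤ) • 1 - (SimpleGraph.pathGraph r).adjMatrix ℤ

/-- `q` has Dynkin type `𝔸_r`: up to an invertible change of variables over `ℤ`, it is the orthogonal
sum of `q_{𝔸_r}` and the zero form in `c` variables. (Both sides of the equation are doubled, as
`q_{𝔸_r}(y) = ½ yᵗ (2 Id - Adj(𝔸_r)) y`.) -/
def HasDynkinTypeA (q : IntForm n) (r : ℕ) : Prop :=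
  ∃ (c : ℕ) (B : (Fin n → ℤ) ≃ₗ[ℤ] (Fin r → ℤ) × (Fin c → ℤ)),
    ∀ x, 2 * q x = (B x).1 ⬝ᵥ (gramA r).mulVec (B x).1

/-- The radical of `q`: the kernel of its polarization. -/
def rad (q : IntForm n) : Submodule ℤ (Fin n → ℤ) := LinearMap.ker (QuadraticMap.polarBilin q)

/-- The corank of `q`: the rank of its radical. -/
def corank (q : IntForm n) : ℕ := Module.finrank ℤ (rad q)

/-- The standard morsification of `q`: the bilinear form `b` with `b(x, x) = q(x)` whose Gram matrix
in the canonical basis is upper triangular. -/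
def morsification (q : IntForm n) : LinearMap.BilinForm ℤ (Fin n → ℤ) :=
  q.toBilin (Pi.basisFun ℤ (Fin n))

/-- The restriction of the standard morsification of `q` to the radical of `q`. -/
def radForm (q : IntForm n) : LinearMap.BilinForm ℤ (rad q) :=
  (morsification q).domRestrict₁₂ (rad q) (rad q)

/-- The reduced radical of `q`: those `x` in the radical such that `b(y, x) = 0` for all `y` in the
radical, where `b` is the standard morsification. -/
def reducedRad (q : IntForm n) : Submodule ℤ (Fin n → ℤ) where
  carrier := {x | x ∈ rad q ∧ ∀ y ∈ rad q, morsification q y x = 0}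
  add_mem' := by
    rintro x x' ⟨hx, hx0⟩ ⟨hx', hx0'⟩
    exact ⟨add_mem hx hx', fun y hy => by rw [map_add, hx0 y hy, hx0' y hy, add_zero]⟩
  zero_mem' := ⟨zero_mem _, fun y _ => map_zero _⟩
  smul_mem' := by
    rintro a x ⟨hx, hx0⟩
    exact ⟨(rad q).smul_mem a hx, fun y hy => by rw [map_smul, hx0 y hy, smul_zero]⟩

/-- The reduced corank of `q`: the rank of its reduced radical. -/
def reducedCorank (q : IntForm n) : ℕ := Module.finrank ℤ (reducedRad q)

/-- The rank of the restriction of the standard morsification of `q` to the radical of `q`. -/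
def radFormRank (q : IntForm n) : ℕ := Module.finrank ℤ (LinearMap.range (radForm q))

/-- The degree of degeneracy of `q`: half of the rank of the (skew-symmetric) restriction of the
standard morsification of `q` to its radical. -/
def degeneracyDegree (q : IntForm n) : ℕ := radFormRank q / 2

/-! ### Quivers -/

/-- A quiver with vertices `0, …, m - 1` and arrows `0, …, n - 1`, both in their natural order. -/
structure OrdQuiver (m n : ℕ) where
  /-- the source of an arrow -/
  src : Fin n → Fin m
  /-- the target of an arrow -/
  tgt : Fin n → Fin m

namespace OrdQuiver

variable (Q : OrdQuiver m n)

/-- `Q` has no loops. -/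
def Loopless : Prop := ∀ i, Q.src i ≠ Q.tgt i

/-- The underlying simple graph of `Q`. -/
def graph : SimpleGraph (Fin m) := SimpleGraph.fromRel fun v w => ∃ i, Q.src i = v ∧ Q.tgt i = w

/-- `Q` is connected. -/
def Connected : Prop := Q.graph.Connected

/-- The incidence matrix of `Q`, with `i`-th column `e_{src i} - e_{tgt i}`. -/
def incidence : Matrix (Fin m) (Fin n) ℤ :=
  Matrix.of fun v i => (Pi.single (Q.src i) 1 - Pi.single (Q.tgt i) 1 : Fin m → ℤ) v

/-- `q` is the quadratic form `q_Q` of the quiver `Q`: `q(x) = ½ ‖I(Q) x‖²`. -/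
def Realizes (q : IntForm n) : Prop :=
  ∀ x, 2 * q x = Q.incidence.mulVec x ⬝ᵥ Q.incidence.mulVec x

/-- The source of `i⁺¹` (encoded as `(i, true)`) or of `i⁻¹` (encoded as `(i, false)`). -/
def start (a : Fin n × Bool) : Fin m := if a.2 then Q.src a.1 else Q.tgt a.1

/-- The target of `i⁺¹` or of `i⁻¹`. -/
def finish (a : Fin n × Bool) : Fin m := if a.2 then Q.tgt a.1 else Q.src a.1

/-- `i₁^{ε₁} ⋯ i_ℓ^{ε_ℓ}` is a walk from `v` to `u`. The empty list is the trivial walk at `v = u`. -/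
def IsWalk : Fin m → List (Fin n × Bool) → Fin m → Prop
  | v, [], u => v = u
  | v, a :: w, u => Q.start a = v ∧ IsWalk (Q.finish a) w u

/-- `w` is minimally descending: for consecutive steps `a`, `b`, the arrow of `b` is smaller than the
arrow of `a`, and it is the largest among the arrows `j` smaller than that of `a` for which
`a j^{±1}` is a walk. -/
def MinDescending (w : List (Fin n × Bool)) : Prop :=
  w.IsChain fun a b =>
    b.1 < a.1 ∧ ∀ (j : Fin n) (ε : Bool), j < a.1 → Q.start (j, ε) = Q.finish a → j ≤ b.1

/-- `w` is a descending structural walk from `v` to `u`: a minimally descending walk that is not a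
proper part of another one. -/
def IsStructural (v : Fin m) (w : List (Fin n × Bool)) (u : Fin m) : Prop :=
  Q.IsWalk v w u ∧ Q.MinDescending w ∧
    ∀ (v' : Fin m) (w' w'' : List (Fin n × Bool)) (u' : Fin m),
      Q.IsWalk v' w' v → Q.IsWalk u w'' u' → Q.MinDescending (w' ++ w ++ w'') → w' = [] ∧ w'' = []

/-! Facts needed to see that every vertex is the source of a structural walk, and that sending this
vertex to the target of the walk is a permutation of the vertices. -/

theorem start_flip (a : Fin n × Bool) : Q.start (a.1, !a.2) = Q.finish a := by
  rcases a with ⟨j, _ | _⟩ <;> simp [start, finish]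

theorem finish_flip (a : Fin n × Bool) : Q.finish (a.1, !a.2) = Q.start a := by
  rcases a with ⟨j, _ | _⟩ <;> simp [start, finish]

theorem finish_eq {a b : Fin n × Bool} (h : a.1 = b.1) (hs : Q.start a = Q.start b) :
    Q.finish a = Q.finish b := by
  rcases a with ⟨j, _ | _⟩ <;> rcases b with ⟨j', _ | _⟩ <;> simp_all [start, finish]

/-- Auxiliary: from `v`, follow the largest arrow below `k`, and so on downwards, up to `u`. -/
def Greedy : ℕ → Fin m → List (Fin n × Bool) → Fin m → Prop
  | k, v, [], u => v = u ∧ ∀ (j : Fin n) (ε : Bool), j.val < k → Q.start (j, ε) ≠ v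
  | k, v, a :: w, u => Q.start a = v ∧ a.1.val < k ∧
      (∀ (j : Fin n) (ε : Bool), j.val < k → Q.start (j, ε) = v → j ≤ a.1) ∧
      Greedy a.1.val (Q.finish a) w u

/-- Auxiliary: interchange the end points of the arrows below `k`, the largest arrow first. -/
def swaps : ℕ → Equiv.Perm (Fin m)
  | 0 => 1
  | k + 1 => if h : k < n then
      (Equiv.swap (Q.src ⟨k, h⟩) (Q.tgt ⟨k, h⟩)).trans (swaps k) else swaps k

theorem exists_greedy (k : ℕ) (v : Fin m) : ∃ w, Q.Greedy k v w (Q.swaps k v) := by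
  induction k generalizing v with
  | zero => exact ⟨[], by simp [Greedy, swaps]⟩
  | succ k ih =>
    have key : (∀ (j : Fin n) (ε : Bool), j.val = k → Q.start (j, ε) ≠ v) →
        ∃ w, Q.Greedy (k + 1) v w (Q.swaps k v) := by
      intro hno
      obtain ⟨w, hw⟩ := ih v
      refine ⟨w, ?_⟩
      cases w with
      | nil =>
        refine ⟨hw.1, fun j ε hj => ?_⟩
        rcases Nat.lt_succ_iff_lt_or_eq.1 hj with h | h
        · exact hw.2 j ε h
        · exact hno j ε h
      | cons a w =>
        refine ⟨hw.1, hw.2.1.trans (Nat.lt_succ_self k), fun j ε hj hs => ?_, hw.2.2.2⟩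
        rcases Nat.lt_succ_iff_lt_or_eq.1 hj with h | h
        · exact hw.2.2.1 j ε h hs
        · exact absurd hs (hno j ε h)
    by_cases hk : k < n
    · by_cases hv : ∃ ε, Q.start (⟨k, hk⟩, ε) = v
      · obtain ⟨ε, hε⟩ := hv
        obtain ⟨w, hw⟩ := ih (Q.finish (⟨k, hk⟩, ε))
        refine ⟨(⟨k, hk⟩, ε) :: w, hε, Nat.lt_succ_self k,
          fun j _ hj _ => Fin.le_def.2 (Nat.lt_succ_iff.1 hj), ?_⟩
        have : Q.swaps (k + 1) v = Q.swaps k (Q.finish (⟨k, hk⟩, ε)) := by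
          cases ε <;> simp_all [swaps, start, finish]
        rw [this]
        exact hw
      · push Not at hv
        have : Q.swaps (k + 1) v = Q.swaps k v := by
          have h1 := hv true
          have h2 := hv false
          simp only [start, if_true, Bool.false_eq_true, if_false] at h1 h2
          simp [swaps, hk, Equiv.swap_apply_of_ne_of_ne h1.symm h2.symm]
        rw [this]
        refine key fun j ε hj => ?_
        have : j = ⟨k, hk⟩ := Fin.ext hj
        rw [this]
        exact hv ε
    · have : Q.swaps (k + 1) v = Q.swaps k v := by simp [swaps, hk]
      rw [this]
      exact key fun j _ hj => absurd (hj ▸ j.isLt) hk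

theorem Greedy.unique {k : ℕ} {v : Fin m} {w w' : List (Fin n × Bool)} {u u' : Fin m}
    (h : Q.Greedy k v w u) (h' : Q.Greedy k v w' u') : u = u' := by
  induction w generalizing k v w' with
  | nil =>
    cases w' with
    | nil => exact h.1.symm.trans h'.1
    | cons a' w' => exact absurd h'.1 (h.2 a'.1 a'.2 h'.2.1)
  | cons a w ih =>
    cases w' with
    | nil => exact absurd h.1 (h'.2 a.1 a.2 h.2.1)
    | cons a' w' =>
      have e : a.1 = a'.1 :=
        le_antisymm (h'.2.2.1 a.1 a.2 h.2.1 h.1) (h.2.2.1 a'.1 a'.2 h'.2.1 h'.1)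
      have hf := Q.finish_eq e (h.1.trans h'.1.symm)
      have h2 := h'.2.2.2
      rw [← hf, ← e] at h2
      exact ih h.2.2.2 h2

theorem Greedy.isWalk {k : ℕ} {v : Fin m} {w : List (Fin n × Bool)} {u : Fin m}
    (h : Q.Greedy k v w u) : Q.IsWalk v w u := by
  induction w generalizing k v with
  | nil => exact h.1
  | cons a w ih => exact ⟨h.1, ih h.2.2.2⟩

theorem Greedy.minDescending {k : ℕ} {v : Fin m} {w : List (Fin n × Bool)} {u : Fin m}
    (h : Q.Greedy k v w u) : Q.MinDescending w := by
  induction w generalizing k v with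
  | nil => exact List.IsChain.nil
  | cons a w ih =>
    have ih' := ih h.2.2.2
    cases w with
    | nil => exact List.IsChain.singleton a
    | cons b w =>
      refine List.IsChain.cons_cons ⟨h.2.2.2.2.1, fun j ε hj hs => ?_⟩ ih'
      exact h.2.2.2.2.2.1 j ε hj hs

theorem Greedy.no_extension {k : ℕ} {v : Fin m} {w : List (Fin n × Bool)} {u : Fin m}
    (h : Q.Greedy k v w u) (c : Fin n × Bool) (hc : Q.start c = u) (hk : c.1.val < k)
    (hl : ∀ a ∈ w.getLast?, c.1 < a.1) : False := by
  induction w generalizing k v with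
  | nil => exact h.2 c.1 c.2 hk (hc.trans h.1.symm)
  | cons a w ih =>
    cases w with
    | nil => exact h.2.2.2.2 c.1 c.2 (hl a (by simp)) (hc.trans h.2.2.2.1.symm)
    | cons b w =>
      have hl' : ∀ d ∈ (b :: w).getLast?, c.1 < d.1 := fun d hd =>
        hl d (by rw [List.getLast?_cons_cons]; exact hd)
      refine ih h.2.2.2 ?_ hl'
      have hch : (b :: w).IsChain fun x y => y.1 < x.1 :=
        (Greedy.minDescending Q h.2.2.2).imp fun _ _ hxy => hxy.1
      have hba : b.1 < a.1 := h.2.2.2.2.1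
      have hle : ∀ d ∈ (b :: w), d.1 ≤ b.1 := by
        have : IsTrans (Fin n × Bool) fun x y => y.1 < x.1 := ⟨fun _ _ _ h1 h2 => h2.trans h1⟩
        have hp := List.isChain_iff_pairwise.1 hch
        intro d hd
        rcases List.mem_cons.1 hd with rfl | hd
        · exact le_rfl
        · exact ((List.pairwise_cons.1 hp).1 d hd).le
      have hmem := List.getLast_mem (List.cons_ne_nil b w)
      have h1 := hl' _ (List.getLast?_eq_getLast_of_ne_nil (List.cons_ne_nil b w))
      exact (h1.trans_le (hle _ hmem)).trans hba

theorem IsWalk.finish_last {v : Fin m} {w : List (Fin n × Bool)} {u : Fin m}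
    (h : Q.IsWalk v w u) : ∀ a ∈ w.getLast?, Q.finish a = u := by
  induction w generalizing v with
  | nil => simp
  | cons a w ih =>
    cases w with
    | nil => simpa using (show Q.finish a = u from h.2)
    | cons b w => rw [List.getLast?_cons_cons]; exact ih h.2

theorem Greedy.isStructural {v : Fin m} {w : List (Fin n × Bool)} {u : Fin m}
    (h : Q.Greedy n v w u) : Q.IsStructural v w u := by
  refine ⟨h.isWalk, h.minDescending, fun v' w' w'' u' hw' hw'' hm => ?_⟩
  constructor
  · by_contra hne
    obtain ⟨l, b, rfl⟩ := List.eq_nil_or_concat w' |>.resolve_left hne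
    have hb : Q.finish b = v := IsWalk.finish_last Q hw' b (by simp)
    have hs : Q.start (b.1, !b.2) = v := (Q.start_flip b).trans hb
    cases w with
    | nil => exact h.2 b.1 _ b.1.isLt hs
    | cons a w =>
      have h1 := h.2.2.1 b.1 _ b.1.isLt hs
      have h2 : MinDescending Q (b :: a :: (w ++ w'')) := by
        refine List.IsChain.right_of_append (l₁ := l) ?_
        simpa [MinDescending] using hm
      exact absurd (List.isChain_cons_cons.1 h2).1.1 (not_lt.2 h1)
  · cases w'' with
    | nil => rfl
    | cons c w'' =>
      exfalso
      refine Greedy.no_extension Q h c hw''.1 c.1.isLt fun a ha => ?_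
      have h2 : MinDescending Q (w ++ c :: w'') := by
        refine List.IsChain.right_of_append (l₁ := w') ?_
        simpa [MinDescending] using hm
      exact ((List.isChain_append.1 h2).2.2 a ha c (by simp)).1

theorem greedy_of_minDescending {k : ℕ} {v : Fin m} {w : List (Fin n × Bool)} {u : Fin m}
    (hw : Q.IsWalk v w u) (hm : Q.MinDescending w) (hk : ∀ a ∈ w.head?, a.1.val < k)
    (hh : ∀ (j : Fin n) (ε : Bool), j.val < k → Q.start (j, ε) = v → ∃ a ∈ w.head?, j ≤ a.1)
    (he : ∀ (j : Fin n) (ε : Bool), Q.start (j, ε) = u → ∀ a ∈ w.getLast?, ¬ j < a.1) :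
    Q.Greedy k v w u := by
  induction w generalizing k v with
  | nil => exact ⟨hw, fun j ε hj hs => by simpa using hh j ε hj hs⟩
  | cons a w ih =>
    refine ⟨hw.1, hk a (by simp), fun j ε hj hs => by simpa using hh j ε hj hs, ?_⟩
    cases w with
    | nil => exact ⟨hw.2, fun j ε hj hs => he j ε (hs.trans hw.2) a (by simp) hj⟩
    | cons b w =>
      have hc := List.isChain_cons_cons.1 hm
      refine ih hw.2 hc.2 (by simpa using hc.1.1)
        (fun j ε hj hs => ⟨b, by simp, hc.1.2 j ε hj hs⟩) fun j ε hs d hd => he j ε hs d ?_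
      rw [List.getLast?_cons_cons]
      exact hd

theorem IsStructural.greedy {v : Fin m} {w : List (Fin n × Bool)} {u : Fin m}
    (h : Q.IsStructural v w u) : Q.Greedy n v w u := by
  obtain ⟨hw, hm, hmax⟩ := h
  refine Q.greedy_of_minDescending hw hm (fun a _ => a.1.isLt) (fun j ε _ hs => ?_)
    fun j ε hs a ha hlt => ?_
  · by_contra hno
    push Not at hno
    classical
    -- the smallest arrow at `v` that is larger than every possible head of the walk
    let S : Finset (Fin n × Bool) :=
      Finset.univ.filter fun b => Q.start b = v ∧ ∀ a ∈ w.head?, a.1 < b.1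
    have hS : S.Nonempty := ⟨(j, ε), Finset.mem_filter.2 ⟨Finset.mem_univ _, hs, hno⟩⟩
    obtain ⟨b, hb, hbmin⟩ := S.exists_min_image (fun b => b.1) hS
    have hb' : Q.start b = v ∧ ∀ a ∈ w.head?, a.1 < b.1 := (Finset.mem_filter.1 hb).2
    have := (hmax (Q.finish b) [(b.1, !b.2)] [] u
      ⟨Q.start_flip b, (Q.finish_flip b).trans hb'.1⟩ rfl ?_).1
    · simp at this
    · cases w with
      | nil => exact List.IsChain.singleton _
      | cons a w =>
        rw [List.append_nil]
        refine List.IsChain.cons_cons ⟨hb'.2 a (by simp), fun i δ hi hsi => ?_⟩ hm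
        by_contra hlt
        rw [not_le] at hlt
        rw [Q.finish_flip b, hb'.1] at hsi
        exact absurd (hbmin (i, δ) (by simpa [S] using ⟨hsi, hlt⟩)) (not_le.2 hi)
  · classical
    let S : Finset (Fin n × Bool) := Finset.univ.filter fun b => Q.start b = u ∧ b.1 < a.1
    have hS : S.Nonempty := ⟨(j, ε), by simpa [S] using ⟨hs, hlt⟩⟩
    obtain ⟨b, hb, hbmax⟩ := S.exists_max_image (fun b => b.1) hS
    have hb' : Q.start b = u ∧ b.1 < a.1 := (Finset.mem_filter.1 hb).2
    have := (hmax v [] [b] (Q.finish b) rfl ⟨hb'.1, rfl⟩ ?_).2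
    · simp at this
    · rw [List.nil_append]
      refine List.isChain_append.2 ⟨hm, List.IsChain.singleton b, fun x hx y hy => ?_⟩
      obtain rfl : b = y := by simpa using hy
      obtain rfl : a = x := Option.mem_unique ha hx
      refine ⟨hb'.2, fun i δ hi hsi => hbmax (i, δ) ?_⟩
      simpa [S] using ⟨hsi.trans (IsWalk.finish_last Q hw a ha), hi⟩

theorem exists_structural (v : Fin m) :
    ∃ p : List (Fin n × Bool) × Fin m, Q.IsStructural v p.1 p.2 := by
  obtain ⟨w, hw⟩ := Q.exists_greedy n v
  exact ⟨(w, _), Greedy.isStructural Q hw⟩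

/-- `ξ⁻_Q(v)`: the target of the structural walk with source `v`. -/
def xi (v : Fin m) : Fin m := (Q.exists_structural v).choose.2

theorem xi_eq_of_isStructural {v : Fin m} {w : List (Fin n × Bool)} {u : Fin m}
    (h : Q.IsStructural v w u) : Q.xi v = u :=
  Greedy.unique Q (IsStructural.greedy Q (Q.exists_structural v).choose_spec)
    (IsStructural.greedy Q h)

theorem xi_eq_swaps (v : Fin m) : Q.xi v = Q.swaps n v := by
  obtain ⟨w, hw⟩ := Q.exists_greedy n v
  exact Q.xi_eq_of_isStructural (Greedy.isStructural Q hw)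

theorem xi_bijective : Function.Bijective Q.xi := by
  rw [show Q.xi = Q.swaps n from funext Q.xi_eq_swaps]
  exact (Q.swaps n).bijective

/-- The permutation of vertices `ξ⁻_Q` of `Q`. -/
def xiPerm : Equiv.Perm (Fin m) := Equiv.ofBijective Q.xi Q.xi_bijective

open Classical in
/-- The cycle type of `Q`: the partition of the number `m` of vertices given by the cardinalities of
the orbits of `ξ⁻_Q`. -/
def cycleType : Nat.Partition m where
  parts := (Finset.univ.image fun v : Fin m =>
    Finset.univ.filter fun w => Q.xiPerm.SameCycle v w).val.map Finset.card
  parts_pos := by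
    intro i hi
    obtain ⟨s, hs, rfl⟩ := Multiset.mem_map.1 hi
    obtain ⟨v, -, rfl⟩ := Finset.mem_image.1 (Finset.mem_def.2 hs)
    exact Finset.card_pos.2 ⟨v, by simp [Equiv.Perm.SameCycle.refl]⟩
  parts_sum := by
    rw [← Finset.sum_eq_multiset_sum, ← Finset.card_biUnion]
    · convert Finset.card_fin m
      ext v
      simpa using ⟨v, Equiv.Perm.SameCycle.refl _ _⟩
    · intro s hs t ht hst
      obtain ⟨v, -, rfl⟩ := Finset.mem_image.1 hs
      obtain ⟨w, -, rfl⟩ := Finset.mem_image.1 ht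
      refine Finset.disjoint_left.2 fun x hx hx' => hst ?_
      have h1 := (Finset.mem_filter.1 hx).2
      have h2 := (Finset.mem_filter.1 hx').2
      ext y
      simp only [Finset.mem_filter, Finset.mem_univ, true_and]
      exact ⟨fun h => h2.trans (h1.symm.trans h), fun h => h1.trans (h2.symm.trans h)⟩

end OrdQuiver

/-- `π` is the cycle type `ct(q)` of `q`: the cycle type of a connected loop-less quiver `Q` with
`q = q_Q`. -/
def HasCycleType (q : IntForm n) (π : Nat.Partition m) : Prop :=
  ∃ Q : OrdQuiver m n, Q.Connected ∧ Q.Loopless ∧ Q.Realizes q ∧ Q.cycleType = π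

end UnitForm

end

noncomputable section

namespace UnitForm

variable {n m : ℕ}

/-! Write `I` for the incidence map of a quiver realizing `q`, `b` for the morsification and `ξ` for
the vertex permutation. The radical is `ker I`, and connectedness identifies the image of `I` with
the sum-zero lattice of rank `m - 1`, so the corank is `n - m + 1`.

The Gram matrix of `b` is unitriangular, so every `z ∈ ℤ^m` has a unique `x = lift z` with `b(x, y)
= ⟨z, I y⟩`. Solving this system arrow by arrow composes `z` with one transposition per arrow, and
the outcome is `I (lift z) = z - z ∘ ξ` (`comp_swaps`, `inc_lift`). Hence `lift` maps the
`ξ`-invariant functions onto the reduced radical (`map_lift_invariants`), with the constants as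
kernel (`ker_lift`). The reduced corank is therefore the number `ℓ` of orbits minus one.

On the radical `b` is skew, so its rank is the corank minus the reduced corank. This is even by a
sign count: `ξ` is a product of `n` transpositions, and its sign is also `(-1)^(m - ℓ)`.

A quiver exists because sum-zero vectors of norm 2 in `ℤ^(r+1)` are exactly differences of two basis
vectors. The cycle type is well defined because an isometric embedding of the type `𝔸` root lattice
into itself is, up to sign, a relabelling of coordinates (`exists_star_of_roots`), and this
conjugates `ξ`. -/

theorem finrank_range_add_finrank_ker {M N : Type*} [AddCommGroup M] [Module.Finite ℤ M]
    [AddCommGroup N] (f : M →ₗ[ℤ] N) :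
    Module.finrank ℤ (LinearMap.range f) + Module.finrank ℤ (LinearMap.ker f) =
      Module.finrank ℤ M := by
  rw [← f.quotKerEquivRange.finrank_eq, Submodule.finrank_quotient_add_finrank]

/-! ### The standard morsification -/

theorem morsification_self (q : IntForm n) (x : Fin n → ℤ) : morsification q x x = q x := by
  have h := QuadraticMap.toQuadraticMap_toBilin q (Pi.basisFun ℤ (Fin n))
  exact congrArg (fun f : IntForm n => f x) h

theorem morsification_add_swap (q : IntForm n) (x y : Fin n → ℤ) :
    morsification q x y + morsification q y x = QuadraticMap.polar q x y := by
  simp only [QuadraticMap.polar, ← morsification_self, map_add, LinearMap.add_apply]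
  ring

theorem morsification_single (q : IntForm n) (i j : Fin n) :
    morsification q (Pi.single i 1) (Pi.single j 1) =
      if i = j then q (Pi.single i 1)
      else if i < j then QuadraticMap.polar q (Pi.single i 1) (Pi.single j 1) else 0 := by
  have h := QuadraticMap.toBilin_apply q (Pi.basisFun ℤ (Fin n)) i j
  simp only [Pi.basisFun_apply] at h
  exact h

theorem morsification_single_right (q : IntForm n) (x : Fin n → ℤ) (k : Fin n) :
    morsification q x (Pi.single k 1) = x k * q (Pi.single k 1) +
      ∑ j with j < k, x j * QuadraticMap.polar q (Pi.single j 1) (Pi.single k 1) := by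
  have hx : x = ∑ j, x j • (Pi.single j 1 : Fin n → ℤ) := by
    simpa using ((Pi.basisFun ℤ (Fin n)).sum_repr x).symm
  conv_lhs => rw [hx]
  rw [map_sum, LinearMap.sum_apply, ← Finset.add_sum_erase _ _ (Finset.mem_univ k)]
  simp only [map_smul, LinearMap.smul_apply, morsification_single, smul_eq_mul]
  refine congrArg₂ _ (by simp) ?_
  · rw [Finset.sum_filter, ← Finset.add_sum_erase Finset.univ _ (Finset.mem_univ k)]
    simp only [lt_irrefl, if_false, zero_add]
    refine Finset.sum_congr rfl fun j hj => ?_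
    rw [if_neg (Finset.ne_of_mem_erase hj)]
    split_ifs <;> simp

/-- The Gram matrix is upper unitriangular: pairing with the `k`-th basis vector gives `x k` plus
terms in `x j` with `j < k`, which vanish by induction. -/
theorem eq_zero_of_morsification_left {q : IntForm n} (hunit : IsUnitForm q) {x : Fin n → ℤ}
    (h : ∀ y, morsification q x y = 0) : x = 0 := by
  funext k
  induction k using WellFoundedLT.induction with
  | ind k ih =>
    have hk := h (Pi.single k 1)
    rw [morsification_single_right, hunit k, Finset.sum_eq_zero] at hk
    · simpa using hk
    · intro j hj
      rw [ih j (Finset.mem_filter.1 hj).2]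
      simp

theorem morsification_swap_of_mem_rad {q : IntForm n} {x : Fin n → ℤ} (hx : x ∈ rad q)
    (y : Fin n → ℤ) : morsification q y x = -morsification q x y := by
  have h : QuadraticMap.polar q x y = 0 := by
    have := LinearMap.mem_ker.1 hx
    exact congrArg (fun f => f y) this
  have := morsification_add_swap q x y
  omega

/-- The kernel tests the left argument and the reduced radical the right one; skewness on the
radical reconciles them. -/
theorem ker_radForm (q : IntForm n) :
    (LinearMap.ker (radForm q)).map (rad q).subtype = reducedRad q := by
  ext x
  constructor
  · rintro ⟨x, hx, rfl⟩
    refine ⟨x.2, fun y hy => ?_⟩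
    rw [Submodule.subtype_apply, morsification_swap_of_mem_rad x.2]
    have : radForm q x ⟨y, hy⟩ = 0 := by rw [LinearMap.mem_ker.1 hx]; rfl
    exact neg_eq_zero.2 this
  · rintro ⟨hx, h⟩
    refine ⟨⟨x, hx⟩, LinearMap.mem_ker.2 (LinearMap.ext fun y => ?_), rfl⟩
    have := h y y.2
    rw [morsification_swap_of_mem_rad hx] at this
    exact neg_eq_zero.1 this

theorem radFormRank_add_reducedCorank (q : IntForm n) :
    radFormRank q + reducedCorank q = corank q := by
  have h := finrank_range_add_finrank_ker (M := rad q) (N := rad q →ₗ[ℤ] ℤ) (radForm q)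
  have e := LinearEquiv.finrank_eq
    (Submodule.equivMapOfInjective (rad q).subtype (rad q).injective_subtype
      (LinearMap.ker (radForm q)))
  rw [ker_radForm] at e
  rw [e] at h
  exact h

/-! ### Roots of type `𝔸` -/

/-- A nonzero integral vector of sum zero has a positive and a negative entry; their squares already
use up the norm 2. -/
theorem exists_eq_single_sub_single {ι : Type*} [Fintype ι] [DecidableEq ι] {u : ι → ℤ}
    (hsum : ∑ i, u i = 0) (hnorm : u ⬝ᵥ u = 2) :
    ∃ a b, a ≠ b ∧ u = Pi.single a 1 - Pi.single b 1 := by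
  have hne : ∃ i ∈ Finset.univ, u i ≠ 0 := by
    by_contra! h
    have : u = 0 := funext fun i => h i (Finset.mem_univ i)
    simp [this] at hnorm
  obtain ⟨a, -, ha⟩ := Finset.exists_pos_of_sum_zero_of_exists_nonzero u hsum hne
  obtain ⟨b, -, hb⟩ := Finset.exists_pos_of_sum_zero_of_exists_nonzero (s := Finset.univ)
    (fun i => -u i) (by simp [hsum]) (by simpa using hne)
  have hab : a ≠ b := by rintro rfl; omega
  have hle : ∀ s : Finset ι, ∑ i ∈ s, u i * u i ≤ 2 := fun s => by
    rw [← hnorm]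
    exact Finset.sum_le_univ_sum_of_nonneg fun i => mul_self_nonneg (u i)
  have h2 := hle {a, b}
  rw [Finset.sum_pair hab] at h2
  have hb' : u b < 0 := by omega
  have ha1 : u a = 1 := by nlinarith
  have hb1 : u b = -1 := by nlinarith
  refine ⟨a, b, hab, funext fun c => ?_⟩
  by_cases hca : c = a
  · subst hca; simp [ha1, hab]
  by_cases hcb : c = b
  · subst hcb; simp [hb1, hab.symm]
  have h3 := hle {c, a, b}
  rw [Finset.sum_insert (by simp [hca, hcb]), Finset.sum_pair hab, ha1, hb1] at h3
  have : u c = 0 := by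
    have := mul_self_nonneg (u c)
    exact mul_self_eq_zero.1 (by omega)
  simp [this, hca, hcb]

theorem single_sub_single_dotProduct {ι : Type*} [Fintype ι] [DecidableEq ι] (a b : ι)
    (z : ι → ℤ) : (Pi.single a 1 - Pi.single b 1 : ι → ℤ) ⬝ᵥ z = z a - z b := by
  simp [sub_dotProduct]

theorem single_sub_single_inj {ι : Type*} [DecidableEq ι] {a b c d : ι}
    (hab : a ≠ b) (h : (Pi.single a 1 - Pi.single b 1 : ι → ℤ) = Pi.single c 1 - Pi.single d 1) :
    a = c ∧ b = d := by
  have h1 := congrFun h a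
  have h2 := congrFun h b
  simp only [Pi.sub_apply, Pi.single_apply, if_true] at h1 h2
  constructor
  · by_contra hac
    rw [if_neg hac, if_neg hab] at h1
    split_ifs at h1 <;> omega
  · by_contra hbd
    rw [if_neg hbd, if_neg hab.symm] at h2
    split_ifs at h2 <;> omega

/-- Roots of type `𝔸` with pairwise inner products `1` either all have the same positive
coordinate or all have the same negative coordinate. -/
theorem exists_star_of_roots {ι κ : Type*} [Fintype ι] [DecidableEq ι] (o i₀ : κ) (hi₀ : i₀ ≠ o)
    (β : κ → ι → ℤ) (ho : β o = 0) (hsum : ∀ i, ∑ a, β i a = 0)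
    (hnorm : ∀ i, i ≠ o → β i ⬝ᵥ β i = 2)
    (hpair : ∀ i j, i ≠ o → j ≠ o → i ≠ j → β i ⬝ᵥ β j = 1) :
    ∃ f : κ → ι, Function.Injective f ∧
      ((∀ i, β i = Pi.single (f o) 1 - Pi.single (f i) 1) ∨
        ∀ i, β i = Pi.single (f i) 1 - Pi.single (f o) 1) := by
  classical
  -- `β o = 0` is not a root, so the pair chosen at `o` is arbitrary; the root at `i₀` shows that
  -- `ι` is nonempty.
  have hroot : ∀ i, ∃ ab : ι × ι, i ≠ o →
      ab.1 ≠ ab.2 ∧ β i = Pi.single ab.1 1 - Pi.single ab.2 1 := fun i => by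
    by_cases hi : i = o
    · have : Nonempty ι := by
        obtain ⟨a, -⟩ := exists_eq_single_sub_single (hsum i₀) (hnorm i₀ hi₀)
        exact ⟨a⟩
      exact ⟨Classical.arbitrary _, fun h => absurd hi h⟩
    · obtain ⟨a, b, h⟩ := exists_eq_single_sub_single (hsum i) (hnorm i hi)
      exact ⟨(a, b), fun _ => h⟩
  choose p hp using hroot
  -- Two roots have inner product 2 if they share both signed ends and at most 0 if they share
  -- neither.
  have hcommon : ∀ i j, i ≠ o → j ≠ o → i ≠ j →
      ((p i).1 = (p j).1 ∧ (p i).2 ≠ (p j).2) ∨ ((p i).1 ≠ (p j).1 ∧ (p i).2 = (p j).2) := by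
    intro i j hi hj hij
    have h := hpair i j hi hj hij
    rw [(hp i hi).2, (hp j hj).2, single_sub_single_dotProduct] at h
    simp only [Pi.sub_apply, Pi.single_apply] at h
    by_cases h1 : (p i).1 = (p j).1 <;> by_cases h2 : (p i).2 = (p j).2
    · have e1 := (hp i hi).1
      have e2 := (hp j hj).1
      rw [h1] at e1
      rw [h2] at e1
      simp [h1, h2, e1, e1.symm] at h
    · exact Or.inl ⟨h1, h2⟩
    · exact Or.inr ⟨h1, h2⟩
    · simp only [h1, h2, if_false] at h
      split_ifs at h <;> omega
  by_cases hall : ∀ j, j ≠ o → (p j).1 = (p i₀).1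
  · refine ⟨fun i => if i = o then (p i₀).1 else (p i).2, fun i j hij => ?_, Or.inl fun i => ?_⟩
    · by_contra hne
      by_cases hi : i = o <;> by_cases hj : j = o
      · exact hne (hi.trans hj.symm)
      · simp only [hi, hj, if_true, if_false] at hij
        exact (hp j hj).1 ((hall j hj).trans hij)
      · simp only [hi, hj, if_true, if_false] at hij
        exact (hp i hi).1 ((hall i hi).trans hij.symm)
      · simp only [hi, hj, if_false] at hij
        rcases hcommon i j hi hj hne with h | h
        · exact h.2 hij
        · exact h.1 ((hall i hi).trans (hall j hj).symm)
    · by_cases hi : i = o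
      · simp [hi, ho]
      · simp [hi, (hp i hi).2, hall i hi]
  · push Not at hall
    obtain ⟨j, hj, hj1⟩ := hall
    have hj2 : (p j).2 = (p i₀).2 := by
      rcases hcommon j i₀ hj hi₀ (by rintro rfl; exact hj1 rfl) with h | h
      · exact absurd h.1 hj1
      · exact h.2
    -- A root `k` with another negative end would share its positive end with `i₀`, and then neither
    -- end with `j`.
    have hall : ∀ k, k ≠ o → (p k).2 = (p i₀).2 := fun k hk => by
      by_contra hk2
      have h1 : (p k).1 = (p i₀).1 := by
        rcases hcommon k i₀ hk hi₀ (by rintro rfl; exact hk2 rfl) with h | h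
        · exact h.1
        · exact absurd h.2 hk2
      rcases hcommon k j hk hj (by rintro rfl; exact hk2 hj2) with h | h
      · exact hj1 (h.1.symm.trans h1)
      · exact hk2 (h.2.trans hj2)
    refine ⟨fun i => if i = o then (p i₀).2 else (p i).1, fun i j hij => ?_, Or.inr fun i => ?_⟩
    · by_contra hne
      by_cases hi : i = o <;> by_cases hj : j = o
      · exact hne (hi.trans hj.symm)
      · simp only [hi, hj, if_true, if_false] at hij
        exact (hp j hj).1 (hij.symm.trans (hall j hj).symm)
      · simp only [hi, hj, if_true, if_false] at hij
        exact (hp i hi).1 (hij.trans (hall i hi).symm)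
      · simp only [hi, hj, if_false] at hij
        rcases hcommon i j hi hj hne with h | h
        · exact h.2 ((hall i hi).trans (hall j hj).symm)
        · exact h.1 hij
    · by_cases hi : i = o
      · simp [hi, ho]
      · simp [hi, (hp i hi).2, hall i hi]

namespace OrdQuiver

variable (Q : OrdQuiver m n)

/-! ### The incidence map -/

/-- The incidence matrix as a linear map. -/
def inc : (Fin n → ℤ) →ₗ[ℤ] (Fin m → ℤ) := Q.incidence.mulVecLin

theorem inc_single (k : Fin n) :
    Q.inc (Pi.single k 1) = Pi.single (Q.src k) 1 - Pi.single (Q.tgt k) 1 := by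
  ext v
  simp [inc, incidence]

theorem inc_eq_sum (x : Fin n → ℤ) :
    Q.inc x = ∑ k, x k • (Pi.single (Q.src k) 1 - Pi.single (Q.tgt k) 1 : Fin m → ℤ) := by
  have hx : x = ∑ j, x j • (Pi.single j 1 : Fin n → ℤ) := by
    simpa using ((Pi.basisFun ℤ (Fin n)).sum_repr x).symm
  conv_lhs => rw [hx]
  simp only [map_sum, map_smul, inc_single]

theorem inc_dotProduct (x : Fin n → ℤ) (z : Fin m → ℤ) :
    Q.inc x ⬝ᵥ z = ∑ k, x k * (z (Q.src k) - z (Q.tgt k)) := by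
  simp only [inc_eq_sum, sum_dotProduct, smul_dotProduct, single_sub_single_dotProduct, smul_eq_mul]

theorem sum_inc (x : Fin n → ℤ) : ∑ v, Q.inc x v = 0 := by
  have := Q.inc_dotProduct x 1
  simpa [dotProduct] using this

variable {Q}

theorem Realizes.polar {q : IntForm n} (h : Q.Realizes q) (x y : Fin n → ℤ) :
    QuadraticMap.polar q x y = Q.inc x ⬝ᵥ Q.inc y := by
  have h1 : 2 * q (x + y) = Q.inc (x + y) ⬝ᵥ Q.inc (x + y) := h (x + y)
  have h2 : 2 * q x = Q.inc x ⬝ᵥ Q.inc x := h x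
  have h3 : 2 * q y = Q.inc y ⬝ᵥ Q.inc y := h y
  have h4 := dotProduct_comm (Q.inc y) (Q.inc x)
  simp only [map_add, add_dotProduct, dotProduct_add] at h1
  rw [QuadraticMap.polar]
  omega

/-- The polarization at `(x, x)` is `‖I x‖²`, which is definite in `I x`. -/
theorem Realizes.mem_rad {q : IntForm n} (h : Q.Realizes q) {x : Fin n → ℤ} :
    x ∈ rad q ↔ Q.inc x = 0 := by
  constructor
  · intro hx
    have : QuadraticMap.polar q x x = 0 := congrArg (fun f => f x) (LinearMap.mem_ker.1 hx)
    rw [h.polar] at this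
    exact dotProduct_self_eq_zero.1 this
  · intro hx
    refine LinearMap.mem_ker.2 (LinearMap.ext fun y => ?_)
    change QuadraticMap.polar q x y = 0
    rw [h.polar, hx, zero_dotProduct]

theorem Realizes.rad_eq {q : IntForm n} (h : Q.Realizes q) : rad q = LinearMap.ker Q.inc :=
  Submodule.ext fun _ => h.mem_rad.trans LinearMap.mem_ker.symm

/-! ### Connectedness -/

theorem Connected.rel (hc : Q.Connected) {R : Fin m → Fin m → Prop} (hR : Equivalence R)
    (h : ∀ k, R (Q.src k) (Q.tgt k)) (v w : Fin m) : R v w := by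
  obtain ⟨p⟩ := hc.preconnected v w
  induction p with
  | nil => exact hR.refl _
  | cons hadj _ ih =>
    refine hR.trans ?_ ih
    rcases (SimpleGraph.fromRel_adj _ _ _).1 hadj with ⟨-, ⟨k, rfl, rfl⟩ | ⟨k, rfl, rfl⟩⟩
    · exact h k
    · exact hR.symm (h k)

theorem Connected.const (hc : Q.Connected) {z : Fin m → ℤ}
    (h : ∀ k, z (Q.src k) = z (Q.tgt k)) (v w : Fin m) : z v = z w :=
  hc.rel (R := fun v w => z v = z w) ⟨fun _ => rfl, Eq.symm, Eq.trans⟩ h v w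

theorem Connected.exists_inc (hc : Q.Connected) (v w : Fin m) :
    ∃ x, Q.inc x = Pi.single v 1 - Pi.single w 1 := by
  refine hc.rel (R := fun v w => ∃ x, Q.inc x = Pi.single v 1 - Pi.single w 1)
    ⟨fun v => ⟨0, by simp⟩, ?_, ?_⟩ (fun k => ⟨_, Q.inc_single k⟩) v w
  · rintro v w ⟨x, hx⟩
    exact ⟨-x, by rw [map_neg, hx, neg_sub]⟩
  · rintro u v w ⟨x, hx⟩ ⟨y, hy⟩
    exact ⟨x + y, by rw [map_add, hx, hy, sub_add_sub_cancel]⟩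

theorem connected_of_const [Nonempty (Fin m)]
    (h : ∀ z : Fin m → ℤ, (∀ k, z (Q.src k) = z (Q.tgt k)) → ∀ v w, z v = z w) : Q.Connected := by
  classical
  refine ⟨fun v w => ?_⟩
  -- The test function is the indicator of the component of `v`.
  have key := h (fun u => if Q.graph.Reachable v u then 1 else 0) (fun k => ?_) v w
  · simpa using key
  · by_cases hk : Q.src k = Q.tgt k
    · rw [hk]
    · have hadj : Q.graph.Adj (Q.src k) (Q.tgt k) :=
        (SimpleGraph.fromRel_adj _ _ _).2 ⟨hk, Or.inl ⟨k, rfl, rfl⟩⟩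
      have : Q.graph.Reachable v (Q.src k) ↔ Q.graph.Reachable v (Q.tgt k) :=
        ⟨fun hr => hr.trans hadj.reachable, fun hr => hr.trans hadj.symm.reachable⟩
      simp only [this]

theorem Connected.range_inc (hc : Q.Connected) :
    LinearMap.range Q.inc = LinearMap.ker (∑ v, LinearMap.proj v : (Fin m → ℤ) →ₗ[ℤ] ℤ) := by
  ext u
  rw [LinearMap.mem_ker, LinearMap.sum_apply]
  constructor
  · rintro ⟨x, rfl⟩
    exact Q.sum_inc x
  · intro hu
    obtain ⟨o⟩ := hc.nonempty
    choose x hx using fun v => hc.exists_inc v o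
    -- The contributions at the base vertex `o` cancel because `u` has sum zero.
    refine ⟨∑ v, u v • x v, ?_⟩
    have hu' : ∑ v, u v = 0 := hu
    simp only [map_sum, map_smul, hx, smul_sub, Finset.sum_sub_distrib, ← Finset.sum_smul, hu',
      zero_smul, sub_zero]
    simpa using (Pi.basisFun ℤ (Fin m)).sum_repr u

theorem Connected.finrank_range_inc (hc : Q.Connected) :
    Module.finrank ℤ (LinearMap.range Q.inc) + 1 = m := by
  obtain ⟨o⟩ := hc.nonempty
  rw [hc.range_inc]
  set s : (Fin m → ℤ) →ₗ[ℤ] ℤ := ∑ v, LinearMap.proj v with hs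
  have hsurj : LinearMap.range s = ⊤ := LinearMap.range_eq_top.2 fun a =>
    ⟨Pi.single o a, by simp [hs, LinearMap.sum_apply]⟩
  have h := finrank_range_add_finrank_ker s
  rw [hsurj, finrank_top, Module.finrank_self, Module.finrank_fin_fun] at h
  omega

theorem Connected.corank_add (hc : Q.Connected) {q : IntForm n} (h : Q.Realizes q) :
    corank q + m = n + 1 := by
  have h1 := hc.finrank_range_inc
  have h2 := finrank_range_add_finrank_ker Q.inc
  rw [Module.finrank_fin_fun] at h2
  rw [corank, h.rad_eq]
  omega

/-! ### The reduced radical -/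

theorem xiPerm_eq_swaps : Q.xiPerm = Q.swaps n := Equiv.ext Q.xi_eq_swaps

theorem swaps_succ (k : Fin n) :
    Q.swaps (k + 1) = (Equiv.swap (Q.src k) (Q.tgt k)).trans (Q.swaps k) := by
  simp [swaps]

variable (Q)

/-- For `z ∈ ℤ^m`, the vector `x` with `b(x, y) = ⟨z, I(Q) y⟩` for all `y`, where `b` is the standard
morsification of the quadratic form of `Q`. -/
def lift : (Fin m → ℤ) →ₗ[ℤ] (Fin n → ℤ) where
  toFun z k := z (Q.swaps k (Q.src k)) - z (Q.swaps k (Q.tgt k))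
  map_add' z z' := by ext k; simp only [Pi.add_apply]; ring
  map_smul' a z := by ext k; simp only [Pi.smul_apply, smul_eq_mul, RingHom.id_apply]; ring

/-- Composing with a transposition is the reflection in the root `e_a - e_b`. -/
theorem comp_swap (f : Fin m → ℤ) (a b : Fin m) :
    f ∘ Equiv.swap a b = f - (f a - f b) • (Pi.single a 1 - Pi.single b 1 : Fin m → ℤ) := by
  ext v
  by_cases ha : v = a
  · subst ha
    by_cases hb : v = b
    · subst hb; simp
    · simp [hb]
  by_cases hb : v = b
  · subst hb; simp [ha]
  · simp [Equiv.swap_apply_of_ne_of_ne ha hb, ha, hb]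

/-- Each further arrow applies one more reflection to `z ∘ Q.swaps k`, and the coefficient it
subtracts is by definition the next coordinate of `lift z`. -/
theorem comp_swaps (z : Fin m → ℤ) (k : ℕ) :
    z ∘ Q.swaps k = z - ∑ j : Fin n with j.val < k,
      Q.lift z j • (Pi.single (Q.src j) 1 - Pi.single (Q.tgt j) 1 : Fin m → ℤ) := by
  induction k with
  | zero => simp [swaps]
  | succ k ih =>
    by_cases hk : k < n
    · have hset : Finset.univ.filter (fun j : Fin n => j.val < k + 1) =
          insert ⟨k, hk⟩ (Finset.univ.filter fun j : Fin n => j.val < k) := by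
        ext j
        simp only [Finset.mem_filter, Finset.mem_univ, true_and, Finset.mem_insert, Fin.ext_iff]
        omega
      rw [hset, Finset.sum_insert (by simp), sub_add_eq_sub_sub_swap, ← ih]
      have := comp_swap (z ∘ Q.swaps k) (Q.src ⟨k, hk⟩) (Q.tgt ⟨k, hk⟩)
      rw [show Q.swaps (k + 1) = _ from swaps_succ (Q := Q) ⟨k, hk⟩, Equiv.coe_trans,
        ← Function.comp_assoc, this]
      rfl
    · rw [swaps, dif_neg hk, ih]
      congr 2
      ext j
      simp only [Finset.mem_filter, Finset.mem_univ, true_and]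
      omega

theorem inc_lift (z : Fin m → ℤ) : Q.inc (Q.lift z) = z - z ∘ Q.xiPerm := by
  rw [xiPerm_eq_swaps, comp_swaps, inc_eq_sum, sub_sub_cancel]
  refine Finset.sum_congr (Finset.ext fun j => ?_) fun _ _ => rfl
  simp

variable {Q}

/-- On the basis vector of arrow `k`, `comp_swaps` rewrites the diagonal term as `⟨z, I e_k⟩` minus
exactly the terms that the arrows `j < k` contribute to `b`. -/
theorem Realizes.morsification_lift {q : IntForm n} (h : Q.Realizes q) (hunit : IsUnitForm q)
    (z : Fin m → ℤ) (y : Fin n → ℤ) : morsification q (Q.lift z) y = z ⬝ᵥ Q.inc y := by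
  have : morsification q (Q.lift z) = (dotProductBilin ℤ ℤ z) ∘ₗ Q.inc := by
    refine (Pi.basisFun ℤ (Fin n)).ext fun k => ?_
    simp only [Pi.basisFun_apply, LinearMap.comp_apply]
    change _ = z ⬝ᵥ Q.inc (Pi.single k 1)
    rw [morsification_single_right, hunit k, mul_one]
    have hz : Q.lift z k = (z ∘ Q.swaps k) ⬝ᵥ Q.inc (Pi.single k 1) := by
      rw [dotProduct_comm, inc_single, single_sub_single_dotProduct]; rfl
    rw [hz, comp_swaps, sub_dotProduct, sum_dotProduct]
    simp only [smul_dotProduct, h.polar, inc_single, smul_eq_mul, Fin.lt_def]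
    exact sub_add_cancel _ _
  rw [this]
  rfl

variable (Q)

/-- The integral functions on the vertices that are constant on the orbits of `ξ⁻_Q`. -/
def invariants : Submodule ℤ (Fin m → ℤ) := LinearMap.ker (Q.inc ∘ₗ Q.lift)

theorem mem_invariants {z : Fin m → ℤ} : z ∈ Q.invariants ↔ ∀ v, z (Q.xiPerm v) = z v := by
  rw [invariants, LinearMap.mem_ker, LinearMap.comp_apply, inc_lift, sub_eq_zero, eq_comm, funext_iff]
  rfl

variable {Q}

/-- For the harder inclusion, `b(x, ·)` vanishes on `ker I`, so it factors through the sum-zero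
lattice and is represented there by some `z`; uniqueness of the lift gives `x = lift z`. -/
theorem map_lift_invariants (hc : Q.Connected) {q : IntForm n} (h : Q.Realizes q)
    (hunit : IsUnitForm q) : Q.invariants.map Q.lift = reducedRad q := by
  ext x
  constructor
  · rintro ⟨z, hz, rfl⟩
    have hr : Q.lift z ∈ rad q := h.mem_rad.2 hz
    refine ⟨hr, fun y hy => ?_⟩
    rw [morsification_swap_of_mem_rad hr, h.morsification_lift hunit, h.mem_rad.1 hy,
      dotProduct_zero, neg_zero]
  · rintro ⟨hx, hx0⟩
    have hleft : ∀ y, Q.inc y = 0 → morsification q x y = 0 := fun y hy => by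
      have := hx0 y (h.mem_rad.2 hy)
      rwa [morsification_swap_of_mem_rad hx, neg_eq_zero] at this
    obtain ⟨o⟩ := hc.nonempty
    choose y hy using fun v => hc.exists_inc v o
    set z : Fin m → ℤ := fun v => morsification q x (y v) with hz
    have hxz : x = Q.lift z := by
      refine sub_eq_zero.1 (eq_zero_of_morsification_left hunit fun t => ?_)
      rw [map_sub, LinearMap.sub_apply, h.morsification_lift hunit, dotProduct_comm,
        sub_eq_zero]
      -- This vector lies in `ker I`: the entries of `I t` sum to zero, so the `e_o` terms drop out.
      have := hleft (t - ∑ v, Q.inc t v • y v) ?_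
      · rw [map_sub, sub_eq_zero] at this
        rw [this, map_sum]
        simp only [map_smul, smul_eq_mul, dotProduct, hz]
      · simp only [map_sub, map_sum, map_smul, hy, smul_sub, Finset.sum_sub_distrib,
          ← Finset.sum_smul, Q.sum_inc, zero_smul, sub_zero]
        rw [sub_eq_zero]
        simpa using ((Pi.basisFun ℤ (Fin m)).sum_repr (Q.inc t)).symm
    refine ⟨z, ?_, hxz.symm⟩
    change Q.inc (Q.lift z) = 0
    rw [← hxz]
    exact h.mem_rad.1 hx

/-- If the lift vanishes, `z` is orthogonal to every column of `I`, so it agrees at the ends of each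
arrow and is constant by connectedness. -/
theorem ker_lift (hc : Q.Connected) {q : IntForm n} (h : Q.Realizes q) (hunit : IsUnitForm q) :
    LinearMap.ker Q.lift = ℤ ∙ (1 : Fin m → ℤ) := by
  ext z
  rw [LinearMap.mem_ker, Submodule.mem_span_singleton]
  constructor
  · intro hz
    obtain ⟨o⟩ := hc.nonempty
    refine ⟨z o, funext fun v => ?_⟩
    simp only [Pi.smul_apply, Pi.one_apply, smul_eq_mul, mul_one]
    refine hc.const (fun k => ?_) o v
    have := h.morsification_lift hunit z (Pi.single k 1)
    rw [hz, map_zero, LinearMap.zero_apply, dotProduct_comm, inc_single,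
      single_sub_single_dotProduct] at this
    omega
  · rintro ⟨a, rfl⟩
    ext k
    simp [lift]

theorem Connected.reducedCorank_add_one (hc : Q.Connected) {q : IntForm n} (h : Q.Realizes q)
    (hunit : IsUnitForm q) : reducedCorank q + 1 = Module.finrank ℤ Q.invariants := by
  have h1 := finrank_range_add_finrank_ker (Q.lift.domRestrict Q.invariants)
  rw [LinearMap.range_domRestrict, map_lift_invariants hc h hunit] at h1
  rw [← h1, reducedCorank]
  congr 1
  have hle : LinearMap.ker Q.lift ≤ Q.invariants := fun z hz => by
    change Q.inc (Q.lift z) = 0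
    rw [LinearMap.mem_ker.1 hz, map_zero]
  have e : LinearMap.ker (Q.lift.domRestrict Q.invariants) ≃ₗ[ℤ] LinearMap.ker Q.lift := by
    rw [LinearMap.ker_domRestrict]
    exact Submodule.comapSubtypeEquivOfLe hle
  obtain ⟨o⟩ := hc.nonempty
  have h1 : (1 : Fin m → ℤ) ≠ 0 := fun h0 => one_ne_zero (congrFun h0 o)
  rw [e.finrank_eq, ker_lift hc h hunit,
    ← (LinearEquiv.toSpanNonzeroSingleton ℤ (Fin m → ℤ) 1 h1).finrank_eq, Module.finrank_self]

variable (Q)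

/-! ### The number of parts of the cycle type -/

open Classical in
theorem card_parts_cycleType : Q.cycleType.parts.card =
    (Finset.univ.image fun v : Fin m =>
      Finset.univ.filter fun w => Q.xiPerm.SameCycle v w).card := by
  rw [cycleType, Multiset.card_map]
  rfl

theorem sameCycle_filter_eq_iff {ι : Type*} [Fintype ι] (σ : Equiv.Perm ι)
    [DecidableRel σ.SameCycle] (v w : ι) :
    (Finset.univ.filter fun u => σ.SameCycle v u) = (Finset.univ.filter fun u => σ.SameCycle w u) ↔
      σ.SameCycle v w := by
  constructor
  · intro h
    have : w ∈ Finset.univ.filter fun u => σ.SameCycle w u := by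
      simp [Equiv.Perm.SameCycle.refl]
    rw [← h] at this
    exact (Finset.mem_filter.1 this).2
  · intro h
    ext u
    simp only [Finset.mem_filter, Finset.mem_univ, true_and]
    exact ⟨h.symm.trans, h.trans⟩

theorem apply_eq_of_sameCycle {ι α : Type*} {σ : Equiv.Perm ι} {z : ι → α}
    (hz : ∀ v, z (σ v) = z v) {v w : ι} (h : σ.SameCycle v w) : z v = z w := by
  obtain ⟨i, rfl⟩ := h
  induction i using Int.induction_on with
  | zero => rfl
  | succ i ih => rw [add_comm, zpow_add, zpow_one, Equiv.Perm.mul_apply, hz, ih]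
  | pred i ih =>
    rw [ih, ← hz ((σ ^ (-(i : ℤ) - 1)) v), ← Equiv.Perm.mul_apply, ← zpow_one_add]
    congr 3
    ring

/-- Invariant functions are the pullbacks of arbitrary functions on the set of orbits. -/
theorem finrank_invariants : Module.finrank ℤ Q.invariants = Q.cycleType.parts.card := by
  classical
  rw [card_parts_cycleType]
  set c : Fin m → Finset (Fin m) := fun v => Finset.univ.filter fun w => Q.xiPerm.SameCycle v w
    with hc
  let S := Finset.univ.image c
  let toS : Fin m → S := fun v => ⟨c v, Finset.mem_image_of_mem c (Finset.mem_univ v)⟩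
  have htoS : ∀ v w, toS v = toS w ↔ Q.xiPerm.SameCycle v w := fun v w => by
    rw [Subtype.mk.injEq]
    exact sameCycle_filter_eq_iff _ v w
  have hsurj : Function.Surjective toS := fun ⟨s, hs⟩ => by
    obtain ⟨v, -, rfl⟩ := Finset.mem_image.1 hs
    exact ⟨v, rfl⟩
  let f : (S → ℤ) →ₗ[ℤ] (Fin m → ℤ) := LinearMap.funLeft ℤ ℤ toS
  have hf : Function.Injective f := LinearMap.funLeft_injective_of_surjective ℤ ℤ toS hsurj
  have hrange : LinearMap.range f = Q.invariants := by
    ext z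
    rw [mem_invariants]
    constructor
    · rintro ⟨g, rfl⟩ v
      have : toS (Q.xiPerm v) = toS v := (htoS _ _).2 ((Equiv.Perm.SameCycle.refl _ _).apply_left)
      simp only [f, LinearMap.funLeft_apply, this]
    · intro hz
      refine ⟨fun s => z (hsurj s).choose, funext fun v => ?_⟩
      exact apply_eq_of_sameCycle hz ((htoS _ _).1 (hsurj (toS v)).choose_spec)
  rw [← hrange, LinearMap.finrank_range_of_inj hf, Module.finrank_fintype_fun_eq_card,
    Fintype.card_coe]

/-! ### Parity: the sign of the vertex permutation and its number of orbits. -/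

theorem sign_eq_pow_card_orbits {ι : Type*} [Fintype ι] [DecidableEq ι] (σ : Equiv.Perm ι) :
    Equiv.Perm.sign σ * (-1) ^ (Finset.univ.image fun v =>
      Finset.univ.filter fun w => σ.SameCycle v w).card = (-1) ^ Fintype.card ι := by
  set c : ι → Finset ι := fun v => Finset.univ.filter fun w => σ.SameCycle v w with hc
  have hmem : ∀ v w, w ∈ c v ↔ σ.SameCycle v w := fun v w => by simp [hc]
  have hsplit : Finset.univ.image c = σ.support.image c ∪ (σ.supportᶜ).image c := by
    rw [← Finset.image_union, Finset.union_compl]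
  have hfix : ∀ v, v ∉ σ.support → ∀ w, σ.SameCycle v w → v = w := fun v hv w hw =>
    Equiv.Perm.SameCycle.eq_of_left hw (Equiv.Perm.notMem_support.1 hv)
  have hdisj : Disjoint (σ.support.image c) ((σ.supportᶜ).image c) := by
    rw [Finset.disjoint_left]
    rintro s hs ht
    obtain ⟨v, hv, rfl⟩ := Finset.mem_image.1 hs
    obtain ⟨w, hw, he⟩ := Finset.mem_image.1 ht
    have hw' := Finset.mem_compl.1 hw
    rw [hfix w hw' v ((sameCycle_filter_eq_iff σ w v).1 he)] at hw'
    exact hw' hv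
  have h2 : ((σ.supportᶜ).image c).card = Fintype.card ι - σ.support.card := by
    rw [Finset.card_image_of_injOn, Finset.card_compl]
    intro v hv w _ he
    exact hfix v (Finset.mem_compl.1 hv) w ((sameCycle_filter_eq_iff σ v w).1 he)
  -- Nontrivial orbits are the supports of the cycle factors, and a factor is determined by its
  -- support.
  have h1 : (σ.support.image c).card = σ.cycleType.card := by
    rw [Equiv.Perm.cycleType_def, Multiset.card_map]
    change _ = σ.cycleFactorsFinset.card
    rw [← Finset.card_image_of_injOn (f := Equiv.Perm.support) (s := σ.cycleFactorsFinset)]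
    · congr 1
      ext s
      simp only [Finset.mem_image]
      constructor
      · rintro ⟨v, hv, rfl⟩
        refine ⟨σ.cycleOf v, Equiv.Perm.cycleOf_mem_cycleFactorsFinset_iff.2 hv, ?_⟩
        ext w
        rw [Equiv.Perm.mem_support_cycleOf_iff, hmem]
        exact and_iff_left hv
      · rintro ⟨p, hp, rfl⟩
        obtain ⟨v, hv⟩ := (Equiv.Perm.mem_cycleFactorsFinset_iff.1 hp).1.nonempty_support
        have hvσ := Equiv.Perm.mem_cycleFactorsFinset_support_le hp hv
        refine ⟨v, hvσ, ?_⟩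
        rw [Equiv.Perm.cycle_is_cycleOf hv hp]
        ext w
        rw [Equiv.Perm.mem_support_cycleOf_iff, hmem]
        exact (and_iff_left hvσ).symm
    · intro p hp p' hp' he
      obtain ⟨v, hv⟩ := (Equiv.Perm.mem_cycleFactorsFinset_iff.1 hp).1.nonempty_support
      rw [Equiv.Perm.cycle_is_cycleOf hv hp,
        Equiv.Perm.cycle_is_cycleOf (he ▸ hv : v ∈ p'.support) hp']
  have hle : σ.support.card ≤ Fintype.card ι := Finset.card_le_univ _
  -- With `p` nontrivial cycles and `s` moved points among `N`, the sign is `(-1)^(s + p)` and there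
  -- are `p + (N - s)` orbits.
  rw [hsplit, Finset.card_union_of_disjoint hdisj, h1, h2, Equiv.Perm.sign_of_cycleType,
    Equiv.Perm.sum_cycleType, ← pow_add]
  have : σ.support.card + σ.cycleType.card +
      (σ.cycleType.card + (Fintype.card ι - σ.support.card)) =
      Fintype.card ι + 2 * σ.cycleType.card := by omega
  rw [this, pow_add, pow_mul, neg_one_sq, one_pow, mul_one]

variable {Q}

theorem Loopless.sign_swaps (hl : Q.Loopless) {k : ℕ} (hk : k ≤ n) :
    Equiv.Perm.sign (Q.swaps k) = (-1) ^ k := by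
  induction k with
  | zero => simp [swaps]
  | succ k ih =>
    rw [show Q.swaps (k + 1) = _ from swaps_succ (Q := Q) ⟨k, hk⟩, Equiv.Perm.sign_trans,
      Equiv.Perm.sign_swap (hl _), ih (by omega), pow_succ]

theorem Loopless.even_sub (hl : Q.Loopless) : Even (n + m + Q.cycleType.parts.card) := by
  classical
  have h := sign_eq_pow_card_orbits Q.xiPerm
  have hs : Equiv.Perm.sign Q.xiPerm = (-1) ^ n := by rw [xiPerm_eq_swaps, hl.sign_swaps le_rfl]
  have hcard : (Finset.univ.image fun v => Finset.univ.filter fun w =>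
      Q.xiPerm.SameCycle v w).card = Q.cycleType.parts.card := by
    rw [card_parts_cycleType]
  rw [hs, hcard, Fintype.card_fin, ← pow_add] at h
  have h2 : (-1 : ℤˣ) ^ (n + m + Q.cycleType.parts.card) = 1 := by
    rw [add_right_comm, pow_add, h, ← pow_add, ← two_mul, pow_mul, neg_one_sq, one_pow]
  by_contra hodd
  rw [(Nat.not_even_iff_odd.1 hodd).neg_one_pow] at h2
  exact absurd h2 (by decide)

/-! ### Uniqueness of the quiver up to relabelling vertices and reversing arrows -/

/-- Both incidence maps have kernel `rad q`, so `I x ↦ I' x` is an isometry on the sum-zero lattice.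
It sends the star of roots `e_o - e_i` to a star; the two possible signs give the two alternatives.
-/
theorem Realizes.exists_relabel {Q Q' : OrdQuiver m n} {q : IntForm n} (hm : 2 ≤ m)
    (hc : Q.Connected) (hl : Q.Loopless) (h : Q.Realizes q) (h' : Q'.Realizes q) :
    ∃ σ : Equiv.Perm (Fin m), ∀ k, (Q'.src k = σ (Q.src k) ∧ Q'.tgt k = σ (Q.tgt k)) ∨
      (Q'.src k = σ (Q.tgt k) ∧ Q'.tgt k = σ (Q.src k)) := by
  let o : Fin m := ⟨0, by omega⟩
  let i₀ : Fin m := ⟨1, by omega⟩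
  have hi₀ : i₀ ≠ o := by simp [i₀, o]
  choose x hx using fun v => hc.exists_inc o v
  have hker : ∀ y y', Q.inc y = Q.inc y' → Q'.inc y = Q'.inc y' := fun y y' he => by
    rw [← sub_eq_zero, ← map_sub, ← h'.mem_rad, h.mem_rad, map_sub, he, sub_self]
  have hdot : ∀ i j, Q'.inc (x i) ⬝ᵥ Q'.inc (x j) =
      (Pi.single o 1 - Pi.single i 1 : Fin m → ℤ) ⬝ᵥ (Pi.single o 1 - Pi.single j 1) :=
    fun i j => by rw [← h'.polar, h.polar, hx, hx]
  obtain ⟨f, hf, hstar⟩ := exists_star_of_roots o i₀ hi₀ (fun i => Q'.inc (x i))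
    ((hker _ 0 (by rw [hx, sub_self, map_zero])).trans (map_zero _)) (fun i => Q'.sum_inc _)
    (fun i hi => by
      rw [hdot, single_sub_single_dotProduct]
      simp [hi, hi.symm])
    (fun i j hi hj hij => by
      rw [hdot, single_sub_single_dotProduct]
      simp [hi, hj.symm, hij])
  -- Uses `e_s - e_t = (e_o - e_t) - (e_o - e_s)`.
  have harrow : ∀ k, (Pi.single (Q'.src k) 1 - Pi.single (Q'.tgt k) 1 : Fin m → ℤ) =
      Q'.inc (x (Q.tgt k)) - Q'.inc (x (Q.src k)) := fun k => by
    rw [← inc_single, ← map_sub]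
    refine hker _ _ ?_
    rw [map_sub, hx, hx, inc_single]
    abel
  refine ⟨Equiv.ofBijective f (Finite.injective_iff_bijective.1 hf), fun k => ?_⟩
  simp only [Equiv.ofBijective_apply]
  have hk := harrow k
  have hne : f (Q.src k) ≠ f (Q.tgt k) := fun e => hl k (hf e)
  rcases hstar with hs | hs
  · left
    rw [hs, hs, sub_sub_sub_cancel_left] at hk
    have := single_sub_single_inj hne hk.symm
    exact ⟨this.1.symm, this.2.symm⟩
  · right
    rw [hs, hs, sub_sub_sub_cancel_right] at hk
    have := single_sub_single_inj hne.symm hk.symm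
    exact ⟨this.1.symm, this.2.symm⟩

/-- A transposition does not see the orientation of its arrow. -/
theorem swaps_relabel {Q Q' : OrdQuiver m n} {σ : Equiv.Perm (Fin m)}
    (h : ∀ k, (Q'.src k = σ (Q.src k) ∧ Q'.tgt k = σ (Q.tgt k)) ∨
      (Q'.src k = σ (Q.tgt k) ∧ Q'.tgt k = σ (Q.src k))) (k : ℕ) (v : Fin m) :
    Q'.swaps k (σ v) = σ (Q.swaps k v) := by
  induction k generalizing v with
  | zero => rfl
  | succ k ih =>
    by_cases hk : k < n
    · have hsw : Equiv.swap (Q'.src ⟨k, hk⟩) (Q'.tgt ⟨k, hk⟩) (σ v) =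
          σ (Equiv.swap (Q.src ⟨k, hk⟩) (Q.tgt ⟨k, hk⟩) v) := by
        rw [← σ.injective.swap_apply]
        rcases h ⟨k, hk⟩ with ⟨h1, h2⟩ | ⟨h1, h2⟩
        · rw [h1, h2]
        · rw [h1, h2, Equiv.swap_comm]
      simp only [swaps, dif_pos hk, Equiv.trans_apply, hsw, ih]
    · simp only [swaps, dif_neg hk, ih]

theorem cycleType_eq_of_semiconj {Q Q' : OrdQuiver m n} (σ : Equiv.Perm (Fin m))
    (h : ∀ v, Q'.xiPerm (σ v) = σ (Q.xiPerm v)) : Q'.cycleType = Q.cycleType := by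
  classical
  have hconj : Q'.xiPerm = σ * Q.xiPerm * σ⁻¹ := Equiv.ext fun v => by
    simpa using h (σ⁻¹ v)
  set c : Fin m → Finset (Fin m) := fun v => Finset.univ.filter fun w => Q.xiPerm.SameCycle v w
    with hcdef
  set c' : Fin m → Finset (Fin m) := fun v => Finset.univ.filter fun w => Q'.xiPerm.SameCycle v w
    with hcdef'
  have hc : ∀ v, c' (σ v) = (c v).map σ.toEmbedding := fun v => by
    ext w
    simp [hcdef, hcdef', hconj, Equiv.Perm.sameCycle_conj]
  have himage : Finset.univ.image c' =
      (Finset.univ.image c).map (Finset.mapEmbedding σ.toEmbedding).toEmbedding := by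
    rw [Finset.map_eq_image, Finset.image_image]
    conv_lhs => rw [← Finset.image_univ_equiv σ, Finset.image_image]
    exact Finset.image_congr fun v _ => hc v
  refine Nat.Partition.ext ?_
  change (Finset.univ.image c').val.map Finset.card = (Finset.univ.image c).val.map Finset.card
  rw [himage, Finset.map_val, Multiset.map_map]
  exact Multiset.map_congr rfl fun s _ => Finset.card_map _

theorem Realizes.cycleType_eq {Q Q' : OrdQuiver m n} {q : IntForm n} (hm : 2 ≤ m)
    (hc : Q.Connected) (hl : Q.Loopless) (h : Q.Realizes q) (h' : Q'.Realizes q) :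
    Q'.cycleType = Q.cycleType := by
  obtain ⟨σ, hσ⟩ := h.exists_relabel hm hc hl h'
  refine cycleType_eq_of_semiconj σ fun v => ?_
  rw [xiPerm_eq_swaps, xiPerm_eq_swaps]
  exact swaps_relabel hσ n v

end OrdQuiver

/-! ### Existence of the quiver -/

/-- The embedding of the root lattice of type `𝔸_r` into `ℤ^{r+1}`, sending the `i`-th simple root to
`e_i - e_{i+1}`. -/
def simpleRootMap (r : ℕ) : (Fin r → ℤ) →ₗ[ℤ] (Fin (r + 1) → ℤ) where
  -- The `i`-th coordinate is `y_i - y_{i-1}`, with zeros beyond both ends.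
  toFun y := (Fin.snoc y 0 : Fin (r + 1) → ℤ) - (Fin.cons 0 y : Fin (r + 1) → ℤ)
  map_add' y y' := by
    ext i
    simp only [Pi.sub_apply, Pi.add_apply]
    have h1 : (Fin.snoc (y + y') 0 : Fin (r + 1) → ℤ) i =
        (Fin.snoc y 0 : Fin (r + 1) → ℤ) i + (Fin.snoc y' 0 : Fin (r + 1) → ℤ) i := by
      induction i using Fin.lastCases <;> simp
    have h2 : (Fin.cons 0 (y + y') : Fin (r + 1) → ℤ) i =
        (Fin.cons 0 y : Fin (r + 1) → ℤ) i + (Fin.cons 0 y' : Fin (r + 1) → ℤ) i := by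
      induction i using Fin.cases <;> simp
    rw [h1, h2]
    ring
  map_smul' a y := by
    ext i
    simp only [Pi.sub_apply, Pi.smul_apply, smul_eq_mul, RingHom.id_apply]
    have h1 : (Fin.snoc (a • y) 0 : Fin (r + 1) → ℤ) i = a * (Fin.snoc y 0 : Fin (r + 1) → ℤ) i := by
      induction i using Fin.lastCases <;> simp
    have h2 : (Fin.cons 0 (a • y) : Fin (r + 1) → ℤ) i =
        a * (Fin.cons 0 y : Fin (r + 1) → ℤ) i := by
      induction i using Fin.cases <;> simp
    rw [h1, h2]
    ring

theorem simpleRootMap_apply {r : ℕ} (y : Fin r → ℤ) : simpleRootMap r y =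
    (Fin.snoc y 0 : Fin (r + 1) → ℤ) - (Fin.cons 0 y : Fin (r + 1) → ℤ) := rfl

theorem sum_simpleRootMap {r : ℕ} (y : Fin r → ℤ) : ∑ i, simpleRootMap r y i = 0 := by
  simp only [simpleRootMap_apply, Pi.sub_apply, Finset.sum_sub_distrib]
  rw [Fin.sum_univ_castSucc, Fin.sum_univ_succ (fun i => (Fin.cons 0 y : Fin (r + 1) → ℤ) i)]
  simp

theorem simpleRootMap_single {r : ℕ} (i : Fin r) :
    simpleRootMap r (Pi.single i 1) = Pi.single i.castSucc 1 - Pi.single i.succ 1 := by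
  rw [simpleRootMap_apply]
  congr 1
  · ext j
    induction j using Fin.lastCases with
    | last => simp [(Fin.castSucc_lt_last i).ne']
    | cast j => simp [Pi.single_apply]
  · ext j
    induction j using Fin.cases with
    | zero => simp [(Fin.succ_ne_zero i).symm]
    | succ j => simp [Pi.single_apply]

/-- The sum of products of neighbours, written as a double sum to match the adjacency matrix of the
path. -/
theorem snoc_dotProduct_cons {r : ℕ} (y : Fin r → ℤ) :
    (Fin.snoc y 0 : Fin (r + 1) → ℤ) ⬝ᵥ (Fin.cons 0 y : Fin (r + 1) → ℤ) =
      ∑ i : Fin r, ∑ j : Fin r, if j.val + 1 = i.val then y i * y j else 0 := by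
  rw [dotProduct, Fin.sum_univ_succ, Finset.sum_comm]
  simp only [Fin.cons_zero, mul_zero, zero_add, Fin.cons_succ]
  refine Finset.sum_congr rfl fun j _ => ?_
  rcases Fin.eq_castSucc_or_eq_last j.succ with ⟨i, hi⟩ | hl
  · have hij : j.val + 1 = i.val := by simpa using congrArg Fin.val hi
    rw [hi, Fin.snoc_castSucc, Finset.sum_eq_single i]
    · rw [if_pos hij]
    · intro k _ hk
      exact if_neg fun e => hk (Fin.ext (e.symm.trans hij))
    · simp
  · have hj : j.val + 1 = r := by simpa using congrArg Fin.val hl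
    rw [hl, Fin.snoc_last, zero_mul, Finset.sum_eq_zero]
    intro k _
    have := k.isLt
    exact if_neg (by omega)

theorem simpleRootMap_dotProduct_self {r : ℕ} (y : Fin r → ℤ) :
    simpleRootMap r y ⬝ᵥ simpleRootMap r y = y ⬝ᵥ (gramA r).mulVec y := by
  classical
  have hss : (Fin.snoc y 0 : Fin (r + 1) → ℤ) ⬝ᵥ (Fin.snoc y 0 : Fin (r + 1) → ℤ) = y ⬝ᵥ y := by
    simp [dotProduct, Fin.sum_univ_castSucc]
  have hcc : (Fin.cons 0 y : Fin (r + 1) → ℤ) ⬝ᵥ (Fin.cons 0 y : Fin (r + 1) → ℤ) = y ⬝ᵥ y := by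
    simp [dotProduct, Fin.sum_univ_succ]
  have hadj : y ⬝ᵥ ((SimpleGraph.pathGraph r).adjMatrix ℤ).mulVec y =
      2 * ((Fin.snoc y 0 : Fin (r + 1) → ℤ) ⬝ᵥ (Fin.cons 0 y : Fin (r + 1) → ℤ)) := by
    rw [two_mul]
    -- The adjacency matrix counts each edge in both directions; exchanging the summations in one
    -- copy supplies the other direction.
    nth_rw 1 [(snoc_dotProduct_cons y).trans Finset.sum_comm]
    rw [snoc_dotProduct_cons, ← Finset.sum_add_distrib]
    simp only [dotProduct, Matrix.mulVec, Finset.mul_sum, ← Finset.sum_add_distrib,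
      SimpleGraph.adjMatrix_apply, SimpleGraph.pathGraph_adj]
    refine Finset.sum_congr rfl fun i _ => Finset.sum_congr rfl fun j _ => ?_
    by_cases h1 : i.val + 1 = j.val
    · have h2 : ¬ j.val + 1 = i.val := by omega
      simp [h1, h2, mul_comm]
    · by_cases h2 : j.val + 1 = i.val <;> simp [h1, h2]
  have hgram : y ⬝ᵥ (gramA r).mulVec y =
      2 * (y ⬝ᵥ y) - y ⬝ᵥ ((SimpleGraph.pathGraph r).adjMatrix ℤ).mulVec y := by
    rw [gramA, Matrix.sub_mulVec, dotProduct_sub, Matrix.smul_mulVec, Matrix.one_mulVec,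
      dotProduct_smul, smul_eq_mul]
  rw [hgram, hadj, simpleRootMap_apply, sub_dotProduct, dotProduct_sub, dotProduct_sub, hss, hcc,
    dotProduct_comm (Fin.cons 0 y : Fin (r + 1) → ℤ) (Fin.snoc y 0)]
  ring

/-- Through the root lattice, `q(x) = ½‖φ x‖²`; since `q(e_k) = 1`, each `φ e_k` is a root and its
two ends define arrow `k`. -/
theorem exists_quiver {n r : ℕ} {q : IntForm n} (hunit : IsUnitForm q) (htype : HasDynkinTypeA q r) :
    ∃ Q : OrdQuiver (r + 1) n, Q.Connected ∧ Q.Loopless ∧ Q.Realizes q := by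
  obtain ⟨c, B, hB⟩ := htype
  let φ : (Fin n → ℤ) →ₗ[ℤ] (Fin (r + 1) → ℤ) :=
    simpleRootMap r ∘ₗ LinearMap.fst ℤ _ _ ∘ₗ B.toLinearMap
  have hφ : ∀ x, 2 * q x = φ x ⬝ᵥ φ x := fun x =>
    (hB x).trans (simpleRootMap_dotProduct_self _).symm
  choose s t hst hφst using fun k => exists_eq_single_sub_single
    (u := φ (Pi.single k 1)) (sum_simpleRootMap _) (by rw [← hφ, hunit k]; rfl)
  let Q : OrdQuiver (r + 1) n := ⟨s, t⟩
  have hinc : Q.inc = φ := (Pi.basisFun ℤ (Fin n)).ext fun k => by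
    rw [Pi.basisFun_apply, OrdQuiver.inc_single, hφst]
  refine ⟨Q, OrdQuiver.connected_of_const fun z hz => ?_, hst, fun x => ?_⟩
  · have hzero : ∀ x, φ x ⬝ᵥ z = 0 := fun x => by
      rw [← hinc, OrdQuiver.inc_dotProduct]
      exact Finset.sum_eq_zero fun k _ => by rw [hz, sub_self, mul_zero]
    -- Every simple root is in the image of `φ`, so `z` is orthogonal to it.
    have hstep : ∀ i : Fin r, z i.castSucc = z i.succ := fun i => by
      have h := hzero (B.symm (Pi.single i 1, 0))
      have h' : φ (B.symm (Pi.single i 1, 0)) = simpleRootMap r (Pi.single i 1) := by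
        simp [φ]
      rw [h', simpleRootMap_single, single_sub_single_dotProduct] at h
      exact sub_eq_zero.1 h
    have hconst : ∀ v, z v = z 0 := fun v => by
      induction v using Fin.induction with
      | zero => rfl
      | succ i ih => rw [← hstep, ih]
    exact fun v w => (hconst v).trans (hconst w).symm
  · change 2 * q x = Q.inc x ⬝ᵥ Q.inc x
    rw [hinc, hφ]

end UnitForm

end

/-! ### The main theorem. -/

theorem mainTheorem12 {n r : ℕ} (hr : 1 ≤ r) (q : UnitForm.IntForm n) (hunit : UnitForm.IsUnitForm q)
    (hconn : UnitForm.IsConnected q) (hnonneg : UnitForm.IsNonneg q) (htype : UnitForm.HasDynkinTypeA q r) :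
    -- the cycle type of `q` is well-defined
    (∃! π : Nat.Partition (r + 1), UnitForm.HasCycleType q π) ∧
    -- the rank that defines the degree of degeneracy is even
    UnitForm.radFormRank q = 2 * UnitForm.degeneracyDegree q ∧
    ∀ π : Nat.Partition (r + 1), UnitForm.HasCycleType q π →
      (UnitForm.reducedCorank q : ℤ) = (π.parts.card : ℤ) - 1 ∧
      (UnitForm.degeneracyDegree q : ℚ) = 1 / 2 * ((UnitForm.corank q : ℚ) - (π.parts.card : ℚ) + 1) := by
  obtain ⟨Q, hc, hl, hQ⟩ := UnitForm.exists_quiver hunit htype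
  have huniq : ∀ π : Nat.Partition (r + 1), UnitForm.HasCycleType q π → π = Q.cycleType := by
    rintro π ⟨Q', -, -, hQ', rfl⟩
    exact hQ.cycleType_eq (by omega) hc hl hQ'
  have hred := hc.reducedCorank_add_one hQ hunit
  rw [Q.finrank_invariants] at hred
  have hcor := hc.corank_add hQ
  have hrank := UnitForm.radFormRank_add_reducedCorank q
  -- The rank is `(n - r) - (ℓ - 1)`, of the same parity as `n + (r + 1) + ℓ`, so halving loses
  -- nothing.
  have hdeg : UnitForm.radFormRank q = 2 * UnitForm.degeneracyDegree q := by
    obtain ⟨a, ha⟩ := hl.even_sub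
    rw [UnitForm.degeneracyDegree]
    omega
  refine ⟨⟨Q.cycleType, ⟨Q, hc, hl, hQ, rfl⟩, huniq⟩, hdeg, fun π hπ => ?_⟩
  rw [huniq π hπ]
  refine ⟨by omega, ?_⟩
  have h : 2 * UnitForm.degeneracyDegree q + Q.cycleType.parts.card = UnitForm.corank q + 1 := by
    omega
  have h' : (2 * UnitForm.degeneracyDegree q + Q.cycleType.parts.card : ℚ) =
      UnitForm.corank q + 1 := by exact_mod_cast h
  linarith
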